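/- Let $d\in\{2,3\}$, $k\ge 1$, let $\Omega\subset\mathbb R^d$ be a polygonal/polyhedral domain (open, bounded, connected), and let $\mathcal T_h$ be a conforming triangulation of $\Omega$ into closed simplices $K$ with diameter $h_K$ and outward unit normal $n$ on $\partial K$; $\mathcal F_h$ is the set of its faces and $\Gamma_0$ their union. Let $\mu,\lambda,\kappa>0$, $0<\alpha\le 1$, $c_0\ge 0$, $\eta>1$ be real numbers. Put $V(K)=[\mathbb P_k(K)]^d$, $Q(K)=\mathbb P_{k-1}(K)$ and $$V_h=\{v_h\in L^2(\Omega)^d: v_h|_K\in V(K)\ \forall K\},\qquad Q_h=\{q_h\in L^2(\Omega): q_h|_K\in Q(K)\ \forall K\},$$ $$\bar V_h=\{\bar v_h\in L^2(\Gamma_0)^d:\bar v_h|_F\in[\mathbb P_k(F)]^d\ \forall F\in\mathcal F_h,\ \bar v_h=0\text{ on }\partial\Omega\},$$ $$\bar Q_h=\{\bar q_h\in L^2(\Gamma_0):\bar q_h|_F\in\mathbb P_k(F)\ \forall F\in\mathcal F_h\},\qquad \bar Q_h^0=\{\bar q_h\in\bar Q_h:\bar q_h=0\text{ on }\partial\Omega\},$$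 $X_h=V_h\times Q_h\times V_h\times Q_h$ and $\bar X_h=\bar V_h\times\bar Q_h\times\bar Q_h^0$. Let $(\cdot,\cdot)_{\mathcal T_h}=\sum_K(\cdot,\cdot)_K$ and $\langle\cdot,\cdot\rangle_{\partial\mathcal T_h}=\sum_K\langle\cdot,\cdot\rangle_{\partial K}$ be the sums of the $L^2$ inner products over the cells and over their boundaries, $\varepsilon(u)=(\nabla u+(\nabla u)^T)/2$, and $$\begin{aligned} d_h((u_h,\bar u_h),(v_h,\bar v_h))={}&(\mu\varepsilon(u_h),\varepsilon(v_h))_{\mathcal T_h}+\langle\tfrac{\eta\mu}{h_K}(u_h-\bar u_h),v_h-\bar v_h\rangle_{\partial\mathcal T_h}\\&-\langle\mu\varepsilon(u_h)n,v_h-\bar v_h\rangle_{\partial\mathcal T_h}-\langle\mu\varepsilon(v_h)n,u_h-\bar u_h\rangle_{\partial\mathcal T_h},\end{aligned}$$ $$b_h(v_h,(q_h,\bar q_h))=-(q_h,\nabla\cdot v_h)_{\mathcal T_h}+\langle\bar q_h,v_h\cdot n\rangle_{\partial\mathcal T_h}.$$ For $x=(u_h,p_{Th},z_h,p_h)$,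 $y=(v_h,q_{Th},w_h,q_h)$ in $X_h$ and $\bar x=(\bar u_h,\bar p_{Th},\bar p_h)$, $\bar y=(\bar v_h,\bar q_{Th},\bar q_h)$ in $\bar X_h$ let $$\begin{aligned}a_h((x,\bar x),(y,\bar y))={}&d_h((u_h,\bar u_h),(v_h,\bar v_h))+b_h(v_h,(p_{Th},\bar p_{Th}))+b_h(u_h,(q_{Th},\bar q_{Th}))\\&+(\kappa^{-1}z_h,w_h)_{\mathcal T_h}+b_h(w_h,(p_h,\bar p_h))+b_h(z_h,(q_h,\bar q_h))\\&-(c_0p_h,q_h)_{\mathcal T_h}-\lambda^{-1}(\alpha p_h-p_{Th},\alpha q_h-q_{Th})_{\mathcal T_h},\end{aligned}$$ and let $a_h|_K$ denote the contribution of the cell $K$ to this sum over cells. Let $(\bar t,s,\tilde s)\mapsto(u_h^L,p_{Th}^L,z_h^L,p_h^L)(\bar t,s,\tilde s)\in X_h$ be local solvers: for all $\bar t\in\bar X_h$, $s\in L^2(\Omega)^d$, $\tilde s\in L^2(\Omega)$, the function $t^L=(u_h^L,p_{Th}^L,z_h^L,p_h^L)(\bar t,s,\tilde s)$ satisfies,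 on every cell $K$ and for all $y=(v,q_T,w,q)\in V(K)\times Q(K)\times V(K)\times Q(K)$, $$a_h((t^L,0),(y,0))|_K=(s,v)_K-(\tilde s,q)_K-a_h((0,\bar t),(y,0))|_K .$$ Let $f\in L^2(\Omega)^d$, $g\in L^2(\Omega)$, put $(u_h^f,p_{Th}^f,z_h^f,p_h^f)=(u_h^L,p_{Th}^L,z_h^L,p_h^L)(0,f,g)$ and, for $\bar y\in\bar X_h$, $(l_u,l_{p_T},l_z,l_p)(\bar y)=(u_h^L,p_{Th}^L,z_h^L,p_h^L)(\bar y,0,0)$. Let $\bar x=(\bar u_h,\bar p_{Th},\bar p_h)\in\bar X_h$ solve $$\bar a_h(\bar x,\bar y)=(f,l_u(\bar y))_{\mathcal T_h}-(g,l_p(\bar y))_{\mathcal T_h}\qquad\forall\,\bar y=(\bar v_h,\bar q_{Th},\bar q_h)\in\bar X_h,$$ where $$\begin{aligned}\bar a_h(\bar x,\bar y)={}&d_h((l_u(\bar x),\bar u_h),(l_u(\bar y),\bar v_h))+(\kappa^{-1}l_z(\bar x),l_z(\bar y))_{\mathcal T_h}\\&+b_h(l_u(\bar y),(l_{p_T}(\bar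 x),\bar p_{Th}))+b_h(l_u(\bar x),(l_{p_T}(\bar y),\bar q_{Th}))\\&+b_h(l_z(\bar y),(l_p(\bar x),\bar p_h))+b_h(l_z(\bar x),(l_p(\bar y),\bar q_h))\\&-(c_0l_p(\bar x),l_p(\bar y))_{\mathcal T_h}-\lambda^{-1}(\alpha l_p(\bar x)-l_{p_T}(\bar x),\alpha l_p(\bar y)-l_{p_T}(\bar y))_{\mathcal T_h}.\end{aligned}$$ Put $u_h=u_h^f+l_u(\bar x)$, $p_{Th}=p_{Th}^f+l_{p_T}(\bar x)$, $z_h=z_h^f+l_z(\bar x)$, $p_h=p_h^f+l_p(\bar x)$ and $x=(u_h,p_{Th},z_h,p_h)$. Then $(x,\bar x)$ solves the HDG discretization of the Biot equations: $$a_h((x,\bar x),(y,\bar y))=(f,v_h)_{\mathcal T_h}-(g,q_h)_{\mathcal T_h}\qquad\forall\,y=(v_h,q_{Th},w_h,q_h)\in X_h,\ \bar y\in\bar X_h.$$ -/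

import Mathlib

open MeasureTheory
open scoped MeasureTheory

noncomputable section

namespace HDGBiot

/-- Euclidean space of dimension `d`. -/
abbrev Space (d : ℕ) : Type := EuclideanSpace ℝ (Fin d)

/-! ### Domain and triangulation -/

/-- `Ω` is an open, bounded, connected set whose boundary lies in finitely many hyperplanes:
a polygonal (`d = 2`) or polyhedral (`d = 3`) domain. -/
structure IsPolyhedralDomain {d : ℕ} (Ω : Set (Space d)) : Prop where
  isOpen : IsOpen Ω
  isConnected : IsConnected Ω
  isBounded : Bornology.IsBounded Ω
  frontier_subset : ∃ S : Set (AffineSubspace ℝ (Space d)), S.Finite ∧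
    (∀ A ∈ S, Module.finrank ℝ A.direction = d - 1) ∧ frontier Ω ⊆ ⋃ A ∈ S, (A : Set (Space d))

/-- A (conforming) triangulation of `Ω`: a finite simplicial complex all of whose simplices are
faces of `d`-simplices of the complex, and which covers exactly the closure of `Ω`. -/
structure Triangulation {d : ℕ} (Ω : Set (Space d)) where
  complex : Geometry.SimplicialComplex ℝ (Space d)
  finite : complex.faces.Finite
  pure : ∀ s ∈ complex.faces, ∃ t ∈ complex.faces, s ⊆ t ∧ t.card = d + 1
  space_eq : complex.space = closure Ω

variable {d : ℕ} {Ω : Set (Space d)}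

/-- The cells `K ∈ 𝒯_h`, given by their `d + 1` vertices. -/
def Triangulation.Cell (T : Triangulation Ω) : Type :=
  {K : Finset (Space d) // K ∈ T.complex.faces ∧ K.card = d + 1}

/-- The faces `F ∈ ℱ_h` (of codimension one), given by their `d` vertices. -/
def Triangulation.Facet (T : Triangulation Ω) : Type :=
  {F : Finset (Space d) // F ∈ T.complex.faces ∧ F.card = d}

instance (T : Triangulation Ω) : Fintype T.Cell :=
  (T.finite.subset (fun _ h => h.1 :
    {K : Finset (Space d) | K ∈ T.complex.faces ∧ K.card = d + 1} ⊆ T.complex.faces)).fintype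

instance (T : Triangulation Ω) : Fintype T.Facet :=
  (T.finite.subset (fun _ h => h.1 :
    {F : Finset (Space d) | F ∈ T.complex.faces ∧ F.card = d} ⊆ T.complex.faces)).fintype

variable {T : Triangulation Ω}

/-- The closed simplex `K`. -/
def Triangulation.Cell.set (K : T.Cell) : Set (Space d) := convexHull ℝ (K.1 : Set (Space d))

/-- The closed face `F`. -/
def Triangulation.Facet.set (F : T.Facet) : Set (Space d) := convexHull ℝ (F.1 : Set (Space d))

/-- The characteristic length `h_K`: the diameter of `K`. -/
def Triangulation.Cell.size (K : T.Cell) : ℝ := Metric.diam K.set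

open scoped Classical in
/-- The faces of which `∂K` is the union. -/
def Triangulation.Cell.facets (K : T.Cell) : Finset T.Facet :=
  Finset.univ.filter fun F => F.1 ⊆ K.1

/-- The `(d-1)`-dimensional surface measure on a face. -/
def Triangulation.Facet.measure (F : T.Facet) : Measure F.set :=
  (μHE[d - 1] : Measure (Space d)).comap Subtype.val

/-- The outward unit normal to `K` on its face `F`: the normalized component, orthogonal to `F`,
of the vector from the barycentre of `K` to the barycentre of `F`. -/
def normal (K : T.Cell) (F : T.Facet) : Space d :=
  let w : Space d := (vectorSpan ℝ (F.1 : Set (Space d)))ᗮ.starProjection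
    (F.1.centroid ℝ id - K.1.centroid ℝ id)
  ‖w‖⁻¹ • w

/-! ### Polynomials and finite element spaces -/

/-- `ℙ_m(K)` for a cell `K`. As `K` has interior points, polynomial functions on `K` are
identified with polynomials. -/
abbrev CellPoly (d m : ℕ) : Type := MvPolynomial.restrictTotalDegree (Fin d) ℝ m

/-- The value of a polynomial at a point. -/
def ev (p : MvPolynomial (Fin d) ℝ) (x : Space d) : ℝ := MvPolynomial.eval (fun i => x i) p

/-- Restriction of polynomials to a subset of space, as a linear map into functions. -/
def restrictPoly (S : Set (Space d)) : MvPolynomial (Fin d) ℝ →ₗ[ℝ] (S → ℝ) where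
  toFun p x := ev p x
  map_add' p q := by ext x; simp [ev]
  map_smul' c p := by ext x; simp [ev]

/-- `ℙ_m(F)`: functions on `F` that are restrictions of polynomials of degree at most `m`. -/
def facetPoly (F : T.Facet) (m : ℕ) : Submodule ℝ (F.set → ℝ) :=
  (MvPolynomial.restrictTotalDegree (Fin d) ℝ m).map (restrictPoly F.set)

/-- `V(K) = ℙ_k(K)^d`. -/
abbrev VK (d k : ℕ) : Type := Fin d → CellPoly d k

/-- `Q(K) = ℙ_{k-1}(K)`, used for `k ≥ 1`. -/
abbrev QK (d k : ℕ) : Type := CellPoly d (k - 1)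

/-- `V_h`: vector fields that are in `ℙ_k(K)^d` on every cell `K`. -/
abbrev Vh (T : Triangulation Ω) (k : ℕ) : Type := T.Cell → VK d k

/-- `Q_h`: functions that are in `ℙ_{k-1}(K)` on every cell `K`. -/
abbrev Qh (T : Triangulation Ω) (k : ℕ) : Type := T.Cell → QK d k

/-- `Q̄_h`: functions on the union of faces that are in `ℙ_k(F)` on every face `F`. -/
abbrev Qbar (T : Triangulation Ω) (k : ℕ) : Type := (F : T.Facet) → facetPoly F k

/-- `Q̄_h⁰`: the members of `Q̄_h` that vanish (almost everywhere) on `∂Ω`. -/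
def Qbar0 (T : Triangulation Ω) (k : ℕ) : Submodule ℝ (Qbar T k) where
  carrier := {q | ∀ F : T.Facet, ∀ᵐ x ∂F.measure, x.1 ∈ frontier Ω → (q F).1 x = 0}
  zero_mem' := fun _ => Filter.Eventually.of_forall fun _ _ => rfl
  add_mem' := by
    intro p q hp hq F
    filter_upwards [hp F, hq F] with x hx hy hm
    simp [hx hm, hy hm]
  smul_mem' := by
    intro c q hq F
    filter_upwards [hq F] with x hx hm
    simp [hx hm]

/-- `V̄_h`: vector fields on the union of faces that are in `ℙ_k(F)^d` on every face `F` and that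
vanish on `∂Ω` (given by their components). -/
abbrev Vbar (T : Triangulation Ω) (k : ℕ) : Type := Fin d → Qbar0 T k

/-- Cell functions on one cell: `V(K) × Q(K) × V(K) × Q(K)`. -/
structure LocalX (d k : ℕ) where
  u : VK d k
  pT : QK d k
  z : VK d k
  p : QK d k

/-- `X_h = V_h × Q_h × V_h × Q_h`. -/
structure CellX (T : Triangulation Ω) (k : ℕ) where
  u : Vh T k
  pT : Qh T k
  z : Vh T k
  p : Qh T k

/-- `X̄_h = V̄_h × Q̄_h × Q̄_h⁰`. -/
structure FacetX (T : Triangulation Ω) (k : ℕ) where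
  u : Vbar T k
  pT : Qbar T k
  p : Qbar0 T k

instance (d k : ℕ) : Zero (LocalX d k) := ⟨⟨0, 0, 0, 0⟩⟩

instance (T : Triangulation Ω) (k : ℕ) : Zero (FacetX T k) := ⟨⟨0, 0, 0⟩⟩

/-- Restriction of a member of `X_h` to a cell. -/
def CellX.on {k : ℕ} (x : CellX T k) (K : T.Cell) : LocalX d k := ⟨x.u K, x.pT K, x.z K, x.p K⟩

/-! ### Pointwise values -/

/-- The value at `x` of a polynomial vector field. -/
def val {m : ℕ} (v : Fin d → CellPoly d m) (x : Space d) : Fin d → ℝ := fun i => ev (v i).1 x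

/-- The divergence. -/
def dvg {m : ℕ} (v : Fin d → CellPoly d m) (x : Space d) : ℝ :=
  ∑ i, ev (MvPolynomial.pderiv i (v i).1) x

/-- The symmetric gradient `ε(v) = (∇v + (∇v)ᵀ) / 2`. -/
def eps {m : ℕ} (v : Fin d → CellPoly d m) (x : Space d) : Matrix (Fin d) (Fin d) ℝ :=
  Matrix.of fun i j => (ev (MvPolynomial.pderiv j (v i).1) x
    + ev (MvPolynomial.pderiv i (v j).1) x) / 2

/-- The value of a face vector field on the face `F`. -/
def barval {k : ℕ} (v : Vbar T k) (F : T.Facet) (x : F.set) : Fin d → ℝ := fun i => ((v i).1 F).1 x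

/-! ### Inner products -/

/-- `(p, q)_K` for scalar functions. -/
def ipS (K : T.Cell) (p q : Space d → ℝ) : ℝ := ∫ x in K.set, p x * q x

/-- `(v, w)_K` for vector functions. -/
def ipV (K : T.Cell) (v w : Space d → Fin d → ℝ) : ℝ := ∫ x in K.set, ∑ i, v x i * w x i

/-- `(σ, τ)_K` for matrix functions. -/
def ipM (K : T.Cell) (σ τ : Space d → Matrix (Fin d) (Fin d) ℝ) : ℝ :=
  ∫ x in K.set, ∑ i, ∑ j, σ x i j * τ x i j

/-- `⟨p, q⟩_{∂K}` for scalar functions, which may take different values on different faces. -/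
def bdS (K : T.Cell) (p q : (F : T.Facet) → F.set → ℝ) : ℝ :=
  ∑ F ∈ K.facets, ∫ x, p F x * q F x ∂F.measure

/-- `⟨v, w⟩_{∂K}` for vector functions. -/
def bdV (K : T.Cell) (v w : (F : T.Facet) → F.set → Fin d → ℝ) : ℝ :=
  ∑ F ∈ K.facets, ∫ x, ∑ i, v F x i * w F x i ∂F.measure

/-! ### Bilinear forms -/

/-- The parameters `μ`, `λ`, `α`, `κ`, `c₀` of the model and the penalty parameter `η`. -/
structure Params where
  mu : ℝ
  lam : ℝ
  alpha : ℝ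
  kappa : ℝ
  c0 : ℝ
  eta : ℝ

variable {k : ℕ}

/-- The contribution of the cell `K` to `d_h`. -/
def dK (P : Params) (K : T.Cell) (u : VK d k) (ub : Vbar T k) (v : VK d k) (vb : Vbar T k) : ℝ :=
  ipM K (fun x => P.mu • eps u x) (eps v)
  + bdV K (fun F x => (P.eta * P.mu / K.size) • (val u x - barval ub F x))
      (fun F x => val v x - barval vb F x)
  - bdV K (fun F x => (P.mu • eps u x).mulVec (normal K F)) (fun F x => val v x - barval vb F x)
  - bdV K (fun F x => (P.mu • eps v x).mulVec (normal K F)) (fun F x => val u x - barval ub F x)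

/-- The contribution of the cell `K` to `b_h`. -/
def bK (K : T.Cell) (v : VK d k) (q : QK d k) (qb : Qbar T k) : ℝ :=
  - ipS K (ev q.1) (dvg v)
  + bdS K (fun F x => (qb F).1 x) (fun F x => ∑ i, val v x i * normal K F i)

/-- The contribution `a_h(·, ·)|_K` of the cell `K` to `a_h`. -/
def aK (P : Params) (K : T.Cell) (x : LocalX d k) (xb : FacetX T k)
    (y : LocalX d k) (yb : FacetX T k) : ℝ :=
  dK P K x.u xb.u y.u yb.u
  + bK K y.u x.pT xb.pT
  + bK K x.u y.pT yb.pT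
  + ipV K (fun s => P.kappa⁻¹ • val x.z s) (val y.z)
  + bK K y.z x.p xb.p.1
  + bK K x.z y.p yb.p.1
  - ipS K (fun s => P.c0 * ev x.p.1 s) (ev y.p.1)
  - P.lam⁻¹ * ipS K (fun s => P.alpha * ev x.p.1 s - ev x.pT.1 s)
      (fun s => P.alpha * ev y.p.1 s - ev y.pT.1 s)

/-- The form `d_h`. -/
def dh (P : Params) (u : Vh T k) (ub : Vbar T k) (v : Vh T k) (vb : Vbar T k) : ℝ :=
  ∑ K, dK P K (u K) ub (v K) vb

/-- The form `b_h`. -/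
def bh (v : Vh T k) (q : Qh T k) (qb : Qbar T k) : ℝ := ∑ K, bK K (v K) (q K) qb

/-- The form `a_h`, its arguments being split into cell part and face part. -/
def ah (P : Params) (x : CellX T k) (xb : FacetX T k) (y : CellX T k) (yb : FacetX T k) : ℝ :=
  ∑ K : T.Cell, aK P K (x.on K) xb (y.on K) yb

/-- `(f, v)_{𝒯_h}` for a data function `f` and `v ∈ V_h`. -/
def dataV (f : Space d → Space d) (v : Vh T k) : ℝ :=
  ∑ K : T.Cell, ipV K (fun x i => f x i) (val (v K))

/-- `(g, q)_{𝒯_h}` for a data function `g` and `q ∈ Q_h`. -/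
def dataS (g : Space d → ℝ) (q : Qh T k) : ℝ := ∑ K : T.Cell, ipS K g (ev (q K).1)

/-- `(x, x̄) ∈ 𝐗_h` solves the HDG discretization of the Biot equations with data `f`, `g`. -/
def SolvesHDG (P : Params) (f : Space d → Space d) (g : Space d → ℝ)
    (x : CellX T k) (xb : FacetX T k) : Prop :=
  ∀ (y : CellX T k) (yb : FacetX T k), ah P x xb y yb = dataV f y.u - dataS g y.p

/-! ### Local solvers and the reduced problem -/

/-- The local linear form `L_K` for face data `tb` and sources `s`, `s'`. -/
def LK (P : Params) (K : T.Cell) (tb : FacetX T k) (s : Space d → Space d) (s' : Space d → ℝ)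
    (y : LocalX d k) : ℝ :=
  ipV K (fun x i => s x i) (val y.u) - ipS K s' (ev y.p.1) - aK P K 0 tb y 0

/-- `l` is the local solver `(t̄, s, s̃) ↦ (u^L, p_T^L, z^L, p^L)`: for all face functions `t̄` and
all square integrable `s`, `s̃`, on each cell `K` the restriction of `l t̄ s s̃` satisfies the local
problem `a_K(t, y) = L_K(y)` for all `y ∈ V(K) × Q(K) × V(K) × Q(K)`. -/
def IsLocalSolver (P : Params)
    (l : FacetX T k → (Space d → Space d) → (Space d → ℝ) → CellX T k) : Prop :=
  ∀ (tb : FacetX T k) (s : Space d → Space d) (s' : Space d → ℝ),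
    MemLp s 2 (volume.restrict Ω) → MemLp s' 2 (volume.restrict Ω) →
    ∀ (K : T.Cell) (y : LocalX d k), aK P K ((l tb s s').on K) 0 y 0 = LK P K tb s s' y

/-- The reduced form `ā_h`, where `l ȳ = (l_u(ȳ), l_{p_T}(ȳ), l_z(ȳ), l_p(ȳ))`. -/
def abar (P : Params) (l : FacetX T k → CellX T k) (xb yb : FacetX T k) : ℝ :=
  dh P (l xb).u xb.u (l yb).u yb.u
  + ∑ K : T.Cell, ipV K (fun s => P.kappa⁻¹ • val ((l xb).z K) s) (val ((l yb).z K))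
  + bh (l yb).u (l xb).pT xb.pT
  + bh (l xb).u (l yb).pT yb.pT
  + bh (l yb).z (l xb).p xb.p.1
  + bh (l xb).z (l yb).p yb.p.1
  - ∑ K : T.Cell, ipS K (fun s => P.c0 * ev ((l xb).p K).1 s) (ev ((l yb).p K).1)
  - P.lam⁻¹ * ∑ K : T.Cell, ipS K
      (fun s => P.alpha * ev ((l xb).p K).1 s - ev ((l xb).pT K).1 s)
      (fun s => P.alpha * ev ((l yb).p K).1 s - ev ((l yb).pT K).1 s)

end HDGBiot

end

open HDGBiot

/-! The argument is static condensation for a symmetric form.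

The form `a_h` is symmetric (`ah_comm`) and additive (`ah_add_left`). Additivity needs every
integrand to be integrable: the integrands are continuous, cells and faces are compact, and the
surface measure of a face is finite (`Triangulation.Facet.isFiniteMeasure`).

Write `t ↦ l t` for the local solver without sources and `x^f` for the local solution with zero
face data, so that `x = x^f + l x̄`. Test functions `(y, ȳ)` split as `(y, 0) + (0, ȳ)`.

* For `(y, 0)` the equations are the local problems: `a_h((x^f, 0), (y, 0))` is the right-hand
  side, and `a_h((l x̄, x̄), (y, 0)) = 0` (`IsLocalSolver.ah_zero_source`).
* For `(0, ȳ)` the right-hand side is zero. Since `a_h((l x̄, x̄), (l ȳ, 0)) = 0`, the reduced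
  form is `ā_h(x̄, ȳ) = a_h((l x̄, x̄), (l ȳ, ȳ)) = a_h((l x̄, x̄), (0, ȳ))`. On the other hand the
  local problem for `x^f` tested with `l ȳ`, the symmetry of `a_h`, and
  `a_h((l ȳ, ȳ), (x^f, 0)) = 0` give
  `(f, l_u ȳ) - (g, l_p ȳ) = a_h((x^f, 0), (l ȳ, 0)) = -a_h((x^f, 0), (0, ȳ))`.
  The reduced problem thus says that `a_h((x^f + l x̄, x̄), (0, ȳ)) = 0`.
-/

namespace HDGBiot

variable {d k : ℕ} {Ω : Set (Space d)} {T : Triangulation Ω}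

/-! ### Sums of cell and face functions -/

noncomputable instance : Add (LocalX d k) :=
  ⟨fun x y => ⟨x.u + y.u, x.pT + y.pT, x.z + y.z, x.p + y.p⟩⟩

noncomputable instance : Add (CellX T k) :=
  ⟨fun x y => ⟨x.u + y.u, x.pT + y.pT, x.z + y.z, x.p + y.p⟩⟩

noncomputable instance : Add (FacetX T k) :=
  ⟨fun x y => ⟨x.u + y.u, x.pT + y.pT, x.p + y.p⟩⟩

noncomputable instance : Zero (CellX T k) := ⟨⟨0, 0, 0, 0⟩⟩

theorem LocalX.mk_add_mk (u u' : VK d k) (pT pT' : QK d k) (z z' : VK d k) (p p' : QK d k) :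
    (⟨u, pT, z, p⟩ : LocalX d k) + ⟨u', pT', z', p'⟩ = ⟨u + u', pT + pT', z + z', p + p'⟩ := rfl

theorem FacetX.mk_add_mk (u u' : Vbar T k) (pT pT' : Qbar T k) (p p' : Qbar0 T k) :
    (⟨u, pT, p⟩ : FacetX T k) + ⟨u', pT', p'⟩ = ⟨u + u', pT + pT', p + p'⟩ := rfl

theorem CellX.add_on (x y : CellX T k) (K : T.Cell) : (x + y).on K = x.on K + y.on K := rfl

theorem CellX.add_zero (x : CellX T k) : x + 0 = x := by
  obtain ⟨u, pT, z, p⟩ := x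
  change CellX.mk (u + 0) (pT + 0) (z + 0) (p + 0) = _
  simp only [_root_.add_zero]

theorem CellX.zero_add (x : CellX T k) : 0 + x = x := by
  obtain ⟨u, pT, z, p⟩ := x
  change CellX.mk (0 + u) (0 + pT) (0 + z) (0 + p) = _
  simp only [_root_.zero_add]

theorem FacetX.zero_add (x : FacetX T k) : 0 + x = x := by
  obtain ⟨u, pT, p⟩ := x
  change FacetX.mk (0 + u) (0 + pT) (0 + p) = _
  simp only [_root_.zero_add]

/-! ### Pointwise additivity and continuity of polynomial fields -/

theorem ev_add (p q : MvPolynomial (Fin d) ℝ) (x : Space d) : ev (p + q) x = ev p x + ev q x := by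
  simp [ev]

theorem continuous_ev (p : MvPolynomial (Fin d) ℝ) : Continuous (ev p) :=
  (MvPolynomial.continuous_eval p).comp (by fun_prop)

theorem val_add {m : ℕ} (u v : Fin d → CellPoly d m) (x : Space d) :
    val (u + v) x = val u x + val v x := by
  ext i
  simp [val, ev_add]

theorem continuous_val {m : ℕ} (v : Fin d → CellPoly d m) : Continuous (val v) :=
  continuous_pi fun _ => continuous_ev _

theorem dvg_add {m : ℕ} (u v : Fin d → CellPoly d m) (x : Space d) :
    dvg (u + v) x = dvg u x + dvg v x := by
  simp [dvg, ev_add, Finset.sum_add_distrib]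

theorem continuous_dvg {m : ℕ} (v : Fin d → CellPoly d m) : Continuous (dvg v) :=
  continuous_finsetSum _ fun _ _ => continuous_ev _

theorem eps_add {m : ℕ} (u v : Fin d → CellPoly d m) (x : Space d) :
    eps (u + v) x = eps u x + eps v x := by
  ext i j
  simp only [eps, Pi.add_apply, Submodule.coe_add, map_add, ev_add, Matrix.of_apply,
    Matrix.add_apply]
  ring

theorem continuous_eps {m : ℕ} (v : Fin d → CellPoly d m) : Continuous (eps v) :=
  continuous_matrix fun _ _ => ((continuous_ev _).add (continuous_ev _)).div_const 2

theorem barval_add (u v : Vbar T k) (F : T.Facet) (x : F.set) :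
    barval (u + v) F x = barval u F x + barval v F x := rfl

theorem continuous_facetPoly {F : T.Facet} (q : facetPoly F k) : Continuous q.1 := by
  obtain ⟨q, p, -, rfl⟩ := q
  exact (continuous_ev p).comp continuous_subtype_val

theorem continuous_barval (v : Vbar T k) (F : T.Facet) : Continuous (barval v F) :=
  continuous_pi fun i => continuous_facetPoly ((v i).1 F)

/-! ### Integrability on cells and faces -/

theorem Triangulation.Cell.isCompact_set (K : T.Cell) : IsCompact K.set :=
  K.1.finite_toSet.isCompact_convexHull ℝ

theorem Triangulation.Facet.isCompact_set (F : T.Facet) : IsCompact F.set :=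
  F.1.finite_toSet.isCompact_convexHull ℝ

theorem integrableOn_cell (K : T.Cell) {φ : Space d → ℝ} (hφ : Continuous φ) :
    IntegrableOn φ K.set :=
  hφ.continuousOn.integrableOn_compact K.isCompact_set

/-- The surface measure of a face is finite: the face is a compact subset of an affine subspace of
dimension `d - 1`, on which the `(d - 1)`-dimensional Hausdorff measure is a Haar measure. -/
theorem Triangulation.Facet.isFiniteMeasure (hd : 1 ≤ d) (F : T.Facet) :
    IsFiniteMeasure F.measure := by
  have hmeas : MeasurableSet F.set := F.isCompact_set.measurableSet
  refine ⟨?_⟩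
  rw [Triangulation.Facet.measure, (MeasurableEmbedding.subtype_coe hmeas).comap_apply,
    Set.image_univ, Subtype.range_coe]
  obtain ⟨p, hp⟩ : F.1.Nonempty := Finset.card_pos.1 (by rw [F.2.2]; omega)
  set W : Submodule ℝ (Space d) := vectorSpan ℝ (F.1 : Set (Space d)) with hW
  have hrank : Module.finrank ℝ W = d - 1 := by
    have h := (T.complex.indep F.2.1).finrank_vectorSpan (n := d - 1)
      (by rw [Fintype.card_coe, F.2.2]; omega)
    have hspan := congrArg (vectorSpan ℝ) (Subtype.range_coe (s := (F.1 : Set (Space d))))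
    exact (LinearEquiv.ofEq _ _ hspan).finrank_eq.symm.trans h
  let j : W → Space d := fun w => (w : Space d) + p
  have hj : Isometry j := (isometry_add_right p).comp W.subtypeₗᵢ.isometry
  -- The face lies in the range of the isometry `j`, which parametrizes its affine span.
  have hsub : F.set ⊆ j '' (j ⁻¹' F.set) := by
    intro x hx
    have hx' : x - p ∈ W := by
      rw [hW, ← direction_affineSpan]
      exact AffineSubspace.vsub_mem_direction (convexHull_subset_affineSpan _ hx)
        (subset_affineSpan _ _ hp)
    have hjx : j ⟨x - p, hx'⟩ = x := sub_add_cancel x p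
    exact ⟨_, by rwa [Set.mem_preimage, hjx], hjx⟩
  refine (measure_mono hsub).trans_lt ?_
  rw [hj.euclideanHausdorffMeasure_image, ← hrank]
  exact (hj.isClosedEmbedding.isCompact_preimage F.isCompact_set).measure_lt_top

theorem integrable_facet (hd : 1 ≤ d) (F : T.Facet) {φ : F.set → ℝ} (hφ : Continuous φ) :
    Integrable φ F.measure := by
  have := F.isFiniteMeasure hd
  have : CompactSpace F.set := isCompact_iff_compactSpace.1 F.isCompact_set
  exact hφ.integrable_of_hasCompactSupport (HasCompactSupport.of_compactSpace φ)

/-! ### Symmetry and additivity of the inner products -/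

theorem ipS_comm (K : T.Cell) (p q : Space d → ℝ) : ipS K p q = ipS K q p := by
  simp only [ipS, mul_comm]

theorem bdV_smul_comm (K : T.Cell) (c : ℝ) (v w : (F : T.Facet) → F.set → Fin d → ℝ) :
    bdV K (fun F x => c • v F x) w = bdV K (fun F x => c • w F x) v := by
  simp only [bdV, Pi.smul_apply, smul_eq_mul, mul_right_comm c]

theorem ipS_add_left (K : T.Cell) {p p' q : Space d → ℝ} (hp : Continuous p)
    (hp' : Continuous p') (hq : Continuous q) :
    ipS K (fun x => p x + p' x) q = ipS K p q + ipS K p' q := by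
  simp only [ipS, add_mul]
  exact integral_add (integrableOn_cell K (hp.mul hq)) (integrableOn_cell K (hp'.mul hq))

theorem ipV_add_left (K : T.Cell) {v v' w : Space d → Fin d → ℝ} (hv : Continuous v)
    (hv' : Continuous v') (hw : Continuous w) :
    ipV K (fun x => v x + v' x) w = ipV K v w + ipV K v' w := by
  simp only [ipV, Pi.add_apply, add_mul, Finset.sum_add_distrib]
  exact integral_add (integrableOn_cell K (by fun_prop)) (integrableOn_cell K (by fun_prop))

theorem ipM_add_left (K : T.Cell) {σ σ' τ : Space d → Matrix (Fin d) (Fin d) ℝ}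
    (hσ : Continuous σ) (hσ' : Continuous σ') (hτ : Continuous τ) :
    ipM K (fun x => σ x + σ' x) τ = ipM K σ τ + ipM K σ' τ := by
  simp only [ipM, Matrix.add_apply, add_mul, Finset.sum_add_distrib]
  refine integral_add (integrableOn_cell K ?_) (integrableOn_cell K ?_) <;>
  exact continuous_finsetSum _ fun i _ => continuous_finsetSum _ fun j _ =>
    (Continuous.matrix_elem (by assumption) i j).mul (hτ.matrix_elem i j)

theorem bdS_add_left (hd : 1 ≤ d) (K : T.Cell) {p p' q : (F : T.Facet) → F.set → ℝ}
    (hp : ∀ F, Continuous (p F)) (hp' : ∀ F, Continuous (p' F)) (hq : ∀ F, Continuous (q F)) :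
    bdS K (fun F x => p F x + p' F x) q = bdS K p q + bdS K p' q := by
  simp only [bdS, add_mul, ← Finset.sum_add_distrib]
  exact Finset.sum_congr rfl fun F _ => integral_add
    (integrable_facet hd F ((hp F).mul (hq F))) (integrable_facet hd F ((hp' F).mul (hq F)))

theorem bdV_add_left (hd : 1 ≤ d) (K : T.Cell) {v v' w : (F : T.Facet) → F.set → Fin d → ℝ}
    (hv : ∀ F, Continuous (v F)) (hv' : ∀ F, Continuous (v' F)) (hw : ∀ F, Continuous (w F)) :
    bdV K (fun F x => v F x + v' F x) w = bdV K v w + bdV K v' w := by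
  simp only [bdV, Pi.add_apply, add_mul, Finset.sum_add_distrib]
  rw [← Finset.sum_add_distrib]
  refine Finset.sum_congr rfl fun F _ => ?_
  have := hv F
  have := hv' F
  have := hw F
  exact integral_add (integrable_facet hd F (by fun_prop)) (integrable_facet hd F (by fun_prop))

theorem bdS_comm (K : T.Cell) (p q : (F : T.Facet) → F.set → ℝ) : bdS K p q = bdS K q p := by
  simp only [bdS, mul_comm]

theorem bdV_comm (K : T.Cell) (v w : (F : T.Facet) → F.set → Fin d → ℝ) :
    bdV K v w = bdV K w v := by
  simp only [bdV, mul_comm]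

/-! ### Symmetry and additivity of the bilinear forms -/

theorem dK_comm (P : Params) (K : T.Cell) (u v : VK d k) (ub vb : Vbar T k) :
    dK P K u ub v vb = dK P K v vb u ub := by
  have h : ipM K (fun x => P.mu • eps u x) (eps v) = ipM K (fun x => P.mu • eps v x) (eps u) := by
    simp only [ipM, Matrix.smul_apply, smul_eq_mul]
    refine integral_congr_ae (.of_forall fun x => ?_)
    exact Finset.sum_congr rfl fun i _ => Finset.sum_congr rfl fun j _ => by ring
  rw [dK, dK, h, bdV_smul_comm]
  ring

theorem dK_add_left (hd : 1 ≤ d) (P : Params) (K : T.Cell) (u u' v : VK d k)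
    (ub ub' vb : Vbar T k) :
    dK P K (u + u') (ub + ub') v vb = dK P K u ub v vb + dK P K u' ub' v vb := by
  have ce (w : VK d k) : Continuous fun x => P.mu • eps w x := (continuous_eps w).const_smul P.mu
  have cj (w : VK d k) (wb : Vbar T k) (F : T.Facet) :
      Continuous fun x : F.set => val w x - barval wb F x :=
    ((continuous_val w).comp continuous_subtype_val).sub (continuous_barval wb F)
  have cs (w : VK d k) (wb : Vbar T k) (F : T.Facet) :
      Continuous fun x : F.set => (P.eta * P.mu / K.size) • (val w x - barval wb F x) :=
    (cj w wb F).const_smul (P.eta * P.mu / K.size)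
  have cn (w : VK d k) (F : T.Facet) :
      Continuous fun x : F.set => (P.mu • eps w x).mulVec (normal K F) :=
    ((ce w).comp continuous_subtype_val).matrix_mulVec continuous_const
  have ej (F : T.Facet) (x : F.set) : val (u + u') x - barval (ub + ub') F x
      = (val u x - barval ub F x) + (val u' x - barval ub' F x) := by
    rw [val_add, barval_add]
    abel
  simp only [dK, ej, eps_add, smul_add, Matrix.add_mulVec]
  rw [ipM_add_left K (ce u) (ce u') (continuous_eps v),
    bdV_add_left hd K (cs u ub) (cs u' ub')
      (cj v vb),
    bdV_add_left hd K (cn u) (cn u') (cj v vb),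
    bdV_comm K (fun F x => (P.mu • eps v x).mulVec (normal K F)),
    bdV_add_left hd K (cj u ub) (cj u' ub') (cn v),
    bdV_comm K (fun F x => val u x - barval ub F x),
    bdV_comm K (fun F x => val u' x - barval ub' F x)]
  ring

theorem continuous_normalTrace (K : T.Cell) (v : VK d k) (F : T.Facet) :
    Continuous fun x : F.set => ∑ i, val v x i * normal K F i := by
  have := continuous_val v
  fun_prop

theorem bK_add_left (hd : 1 ≤ d) (K : T.Cell) (v v' : VK d k) (q : QK d k) (qb : Qbar T k) :
    bK K (v + v') q qb = bK K v q qb + bK K v' q qb := by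
  have h : dvg (v + v') = fun x => dvg v x + dvg v' x := funext (dvg_add v v')
  simp only [bK, h, val_add, Pi.add_apply, add_mul, Finset.sum_add_distrib]
  rw [ipS_comm, ipS_add_left K (continuous_dvg v) (continuous_dvg v') (continuous_ev q.1),
    bdS_comm, bdS_add_left hd K (continuous_normalTrace K v) (continuous_normalTrace K v')
      (fun F => continuous_facetPoly (qb F)),
    ipS_comm K (dvg v), ipS_comm K (dvg v'), bdS_comm K _ (fun F x => (qb F).1 x),
    bdS_comm K _ (fun F x => (qb F).1 x)]
  ring

theorem bK_add_right (hd : 1 ≤ d) (K : T.Cell) (v : VK d k) (q q' : QK d k) (qb qb' : Qbar T k) :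
    bK K v (q + q') (qb + qb') = bK K v q qb + bK K v q' qb' := by
  have h : ev (q + q').1 = fun x => ev q.1 x + ev q'.1 x := funext (ev_add q.1 q'.1)
  have hb : (fun (F : T.Facet) x => ((qb + qb') F).1 x)
      = fun F x => (qb F).1 x + (qb' F).1 x := rfl
  rw [bK, bK, bK, h, hb, ipS_add_left K (continuous_ev _) (continuous_ev _) (continuous_dvg v),
    bdS_add_left hd K (fun F => continuous_facetPoly (qb F))
      (fun F => continuous_facetPoly (qb' F)) (continuous_normalTrace K v)]
  ring

theorem aK_comm (P : Params) (K : T.Cell) (x y : LocalX d k) (xb yb : FacetX T k) :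
    aK P K x xb y yb = aK P K y yb x xb := by
  have hz : ipV K (fun s => P.kappa⁻¹ • val x.z s) (val y.z)
      = ipV K (fun s => P.kappa⁻¹ • val y.z s) (val x.z) := by
    simp only [ipV, Pi.smul_apply, smul_eq_mul]
    exact integral_congr_ae (.of_forall fun x => Finset.sum_congr rfl fun i _ => by ring)
  have hp : ipS K (fun s => P.c0 * ev x.p.1 s) (ev y.p.1)
      = ipS K (fun s => P.c0 * ev y.p.1 s) (ev x.p.1) := by
    simp only [ipS]
    exact integral_congr_ae (.of_forall fun x => by ring)
  rw [aK, aK, dK_comm, hz, hp, ipS_comm K (fun s => P.alpha * ev x.p.1 s - ev x.pT.1 s)]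
  ring

theorem aK_add_left (hd : 1 ≤ d) (P : Params) (K : T.Cell) (x x' y : LocalX d k)
    (xb xb' yb : FacetX T k) :
    aK P K (x + x') (xb + xb') y yb = aK P K x xb y yb + aK P K x' xb' y yb := by
  obtain ⟨u, pT, z, p⟩ := x
  obtain ⟨u', pT', z', p'⟩ := x'
  obtain ⟨ub, pTb, pb⟩ := xb
  obtain ⟨ub', pTb', pb'⟩ := xb'
  have ce (q : QK d k) : Continuous (ev q.1) := continuous_ev q.1
  have cc (q : QK d k) : Continuous fun s => P.c0 * ev q.1 s := (ce q).const_mul _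
  have cz (w : VK d k) : Continuous fun s => P.kappa⁻¹ • val w s :=
    (continuous_val w).const_smul P.kappa⁻¹
  have cs (q qT : QK d k) : Continuous fun s => P.alpha * ev q.1 s - ev qT.1 s :=
    ((ce q).const_mul _).sub (ce qT)
  have es : (fun s => P.alpha * ev (p + p').1 s - ev (pT + pT').1 s) = fun s =>
      (P.alpha * ev p.1 s - ev pT.1 s) + (P.alpha * ev p'.1 s - ev pT'.1 s) := by
    ext s
    simp only [Submodule.coe_add, ev_add]
    ring
  rw [LocalX.mk_add_mk, FacetX.mk_add_mk]
  simp only [aK, es]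
  simp only [Submodule.coe_add, ev_add, val_add, smul_add, mul_add (P.c0)]
  rw [dK_add_left hd, bK_add_right hd, bK_add_left hd, bK_add_right hd, bK_add_left hd,
    ipV_add_left K (cz z) (cz z') (continuous_val y.z),
    ipS_add_left K (cc p) (cc p') (ce y.p),
    ipS_add_left K (cs p pT) (cs p' pT') (cs y.p y.pT)]
  ring

theorem ah_comm (P : Params) (x y : CellX T k) (xb yb : FacetX T k) :
    ah P x xb y yb = ah P y yb x xb :=
  Finset.sum_congr rfl fun _ _ => aK_comm ..

theorem ah_add_left (hd : 1 ≤ d) (P : Params) (x x' y : CellX T k) (xb xb' yb : FacetX T k) :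
    ah P (x + x') (xb + xb') y yb = ah P x xb y yb + ah P x' xb' y yb := by
  simp only [ah, CellX.add_on, aK_add_left hd, Finset.sum_add_distrib]

theorem ah_eq_add_left (hd : 1 ≤ d) (P : Params) (x y : CellX T k) (xb yb : FacetX T k) :
    ah P x xb y yb = ah P x 0 y yb + ah P 0 xb y yb := by
  rw [← ah_add_left hd, CellX.add_zero, FacetX.zero_add]

theorem ah_eq_add_right (hd : 1 ≤ d) (P : Params) (x y : CellX T k) (xb yb : FacetX T k) :
    ah P x xb y yb = ah P x xb y 0 + ah P x xb 0 yb := by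
  rw [ah_comm, ah_eq_add_left hd, ah_comm, ah_comm P 0]

theorem ah_zero_left (hd : 1 ≤ d) (P : Params) (y : CellX T k) (yb : FacetX T k) :
    ah P 0 0 y yb = 0 := by
  simpa using ah_eq_add_left hd P 0 y 0 yb

/-! ### Static condensation -/

/-- The reduced form is `a_h` evaluated at face functions completed by their local solutions. -/
theorem abar_eq_ah (P : Params) (l : FacetX T k → CellX T k) (xb yb : FacetX T k) :
    abar P l xb yb = ah P (l xb) xb (l yb) yb := by
  simp only [abar, ah, aK, dh, bh, CellX.on, Finset.sum_add_distrib, Finset.sum_sub_distrib,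
    Finset.mul_sum]
  ring

/-- The local problems, summed over the cells. -/
theorem IsLocalSolver.ah_eq {P : Params}
    {solver : FacetX T k → (Space d → Space d) → (Space d → ℝ) → CellX T k}
    (h : IsLocalSolver P solver) (tb : FacetX T k) {s : Space d → Space d} {s' : Space d → ℝ}
    (hs : MemLp s 2 (volume.restrict Ω)) (hs' : MemLp s' 2 (volume.restrict Ω)) (y : CellX T k) :
    ah P (solver tb s s') 0 y 0 = dataV s y.u - dataS s' y.p - ah P 0 tb y 0 := by
  simp only [ah, dataV, dataS, ← Finset.sum_sub_distrib, h tb s s' hs hs']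
  rfl

/-- Without sources, the local solution completes the face data so that the local equations hold
with zero right-hand side. -/
theorem IsLocalSolver.ah_zero_source (hd : 1 ≤ d) {P : Params}
    {solver : FacetX T k → (Space d → Space d) → (Space d → ℝ) → CellX T k}
    (h : IsLocalSolver P solver) (tb : FacetX T k) (y : CellX T k) :
    ah P (solver tb 0 0) tb y 0 = 0 := by
  have h0 := h.ah_eq tb MemLp.zero MemLp.zero y
  rw [ah_eq_add_left hd, h0]
  simp [dataV, dataS, ipV, ipS]

end HDGBiot

theorem mainTheorem5 {d k : ℕ} (hd : d = 2 ∨ d = 3) (hk : 1 ≤ k)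
    {Ω : Set (Space d)} (hΩ : IsPolyhedralDomain Ω) (T : Triangulation Ω)
    (P : Params) (hmu : 0 < P.mu) (hlam : 0 < P.lam) (halpha : 0 < P.alpha) (halpha' : P.alpha ≤ 1)
    (hkappa : 0 < P.kappa) (hc0 : 0 ≤ P.c0) (heta : 1 < P.eta)
    (solver : FacetX T k → (Space d → Space d) → (Space d → ℝ) → CellX T k)
    (hsolver : IsLocalSolver P solver)
    (f : Space d → Space d) (g : Space d → ℝ)
    (hf : MemLp f 2 (volume.restrict Ω)) (hg : MemLp g 2 (volume.restrict Ω))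
    (xf : CellX T k) (hxf : xf = solver 0 f g)
    (l : FacetX T k → CellX T k) (hl : ∀ yb, l yb = solver yb 0 0)
    (xb : FacetX T k)
    (hred : ∀ yb : FacetX T k, abar P l xb yb = dataV f (l yb).u - dataS g (l yb).p) :
    SolvesHDG P f g
      { u := xf.u + (l xb).u
        pT := xf.pT + (l xb).pT
        z := xf.z + (l xb).z
        p := xf.p + (l xb).p } xb := by
  have hd1 : 1 ≤ d := by omega
  intro y yb
  have hx : (⟨xf.u + (l xb).u, xf.pT + (l xb).pT, xf.z + (l xb).z, xf.p + (l xb).p⟩ : CellX T k)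
      = xf + l xb := rfl
  have hlocal (y : CellX T k) : ah P xf 0 y 0 = dataV f y.u - dataS g y.p := by
    rw [hxf, hsolver.ah_eq 0 hf hg, ah_zero_left hd1, sub_zero]
  have hzero (tb : FacetX T k) (y : CellX T k) : ah P (l tb) tb y 0 = 0 := by
    rw [hl]
    exact hsolver.ah_zero_source hd1 tb y
  -- The reduced problem, after cancelling the local equations and using `xf` as local solution.
  have hred' : ah P (l xb) xb 0 yb = ah P xf 0 (l yb) 0 := by
    rw [hlocal, ← hred, abar_eq_ah, ah_eq_add_right hd1 P (l xb) (l yb), hzero, zero_add]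
  -- By symmetry, this is the source-free local problem of `l yb` tested with `xf`.
  have hsymm : ah P xf 0 (l yb) 0 + ah P xf 0 0 yb = 0 := by
    rw [← ah_eq_add_right hd1, ah_comm, hzero]
  have hsum (y : CellX T k) (yb : FacetX T k) :
      ah P (xf + l xb) xb y yb = ah P xf 0 y yb + ah P (l xb) xb y yb := by
    rw [← ah_add_left hd1, FacetX.zero_add]
  rw [hx, ah_eq_add_right hd1, hsum, hsum, hlocal, hzero, hred']
  linarith
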